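/- Let $A\in\mathbb R^{m\times m}$, $B\in\mathbb R^{m\times d}$, $C\in\mathbb R^{l\times m}$, $D\in\mathbb R^{m\times n}$, let $R\in\mathbb R^{d\times d}$ be symmetric positive definite, and let $\gamma>0$. For $K\in\mathbb R^{d\times m}$ put $$\mathcal T(K)(s)=(C^\top C+K^\top RK)^{1/2}\,\bigl(sI-(A-BK)\bigr)^{-1}D,\qquad \|\mathcal T(K)\|_\infty=\sup_{\omega\in\mathbb R}\sigma_{\max}\bigl(\mathcal T(K)(i\omega)\bigr),$$ and let $\mathcal K$ be the set of all $K$ such that $A-BK$ is Hurwitz (all eigenvalues have negative real part) and $\|\mathcal T(K)\|_\infty<\gamma$. A stabilizing solution of the continuous-time Riccati equation for $K$ is a symmetric matrix $P\ge 0$ with $$(A-BK)^\top P+P(A-BK)+C^\top C+K^\top RK+\gamma^{-2}PDD^\top P=0$$ such that $A-BK+\gamma^{-2}DD^\top P$ is Hurwitz. **Theorem (implicit regularization for continuous-time mixed design).** Let $K\in\mathcal K$. The Riccati equation for $K$ has exactly one stabilizing solution $P_K$. Let $\eta>0$ and let $K'$ be obtained from $K$ by one step of - natural policy gradient, $K'=K-2\eta\,(RK-B^\top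 P_K)$, with $\eta\le 1/(2\|R\|)$, where $\|\cdot\|$ is the operator norm, or - Gauss–Newton, $K'=K-2\eta\,(K-R^{-1}B^\top P_K)$, with $\eta\le 1/2$. Then $K'\in\mathcal K$, i.e. $A-BK'$ is Hurwitz and $\|\mathcal T(K')\|_\infty<\gamma$. Moreover, the Riccati equation for $K'$ has a stabilizing solution $P_{K'}\ge 0$, so that $A-BK'+\gamma^{-2}DD^\top P_{K'}$ is Hurwitz. -/

import Mathlib

open scoped Matrix Matrix.Norms.L2Operator

noncomputable section

namespace MixedDesign

/-- A real square matrix is Hurwitz if all its complex eigenvalues have negative real part. -/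
def IsHurwitz {m : ℕ} (M : Matrix (Fin m) (Fin m) ℝ) : Prop :=
  ∀ z ∈ spectrum ℂ (M.map Complex.ofReal), z.re < 0

section
open scoped MatrixOrder

/-- The output matrix `(Cᵀ C + Kᵀ R K)^{1/2}`; the square root is the positive semidefinite one. -/
def outputMatrix {m d l : ℕ} (C : Matrix (Fin l) (Fin m) ℝ) (R : Matrix (Fin d) (Fin d) ℝ)
    (K : Matrix (Fin d) (Fin m) ℝ) : Matrix (Fin m) (Fin m) ℝ :=
  CFC.sqrt (Cᵀ * C + Kᵀ * R * K)

end

/-- The strictly proper transfer function `s ↦ H (s I - F)⁻¹ G` of the real state-space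
realization `(F, G, H, 0)`. -/
def transferFunction {m n p : ℕ} (F : Matrix (Fin m) (Fin m) ℝ) (G : Matrix (Fin m) (Fin n) ℝ)
    (H : Matrix (Fin p) (Fin m) ℝ) (s : ℂ) : Matrix (Fin p) (Fin n) ℂ :=
  H.map Complex.ofReal * (s • (1 : Matrix (Fin m) (Fin m) ℂ) - F.map Complex.ofReal)⁻¹ *
    G.map Complex.ofReal

/-- The closed-loop transfer function `𝒯(K)`. -/
def closedLoop {m d n l : ℕ} (A : Matrix (Fin m) (Fin m) ℝ) (B : Matrix (Fin m) (Fin d) ℝ)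
    (C : Matrix (Fin l) (Fin m) ℝ) (D : Matrix (Fin m) (Fin n) ℝ) (R : Matrix (Fin d) (Fin d) ℝ)
    (K : Matrix (Fin d) (Fin m) ℝ) : ℂ → Matrix (Fin m) (Fin n) ℂ :=
  transferFunction (A - B * K) D (outputMatrix C R K)

/-- The continuous-time `H∞` norm `sup_ω σ_max (G(iω))`, as an extended nonnegative real. The norm
of a matrix is the operator norm for Euclidean norms, that is, its largest singular value. -/
def hInftyNorm {p n : ℕ} (G : ℂ → Matrix (Fin p) (Fin n) ℂ) : ENNReal :=
  ⨆ ω : ℝ, ENNReal.ofReal ‖G (Complex.I * (ω : ℂ))‖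

/-- The feasible set `𝒦`: stabilizing gains whose closed loop has `H∞` norm less than `γ`. -/
def feasibleSet {m d n l : ℕ} (A : Matrix (Fin m) (Fin m) ℝ) (B : Matrix (Fin m) (Fin d) ℝ)
    (C : Matrix (Fin l) (Fin m) ℝ) (D : Matrix (Fin m) (Fin n) ℝ) (R : Matrix (Fin d) (Fin d) ℝ)
    (γ : ℝ) : Set (Matrix (Fin d) (Fin m) ℝ) :=
  {K | IsHurwitz (A - B * K) ∧ hInftyNorm (closedLoop A B C D R K) < ENNReal.ofReal γ}

/-- `P ≥ 0` (symmetric) is a stabilizing solution of the Riccati equation associated with `K`: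
`(A-BK)ᵀ P + P (A-BK) + Cᵀ C + Kᵀ R K + γ⁻² P D Dᵀ P = 0` and `A - BK + γ⁻² D Dᵀ P` is Hurwitz. -/
structure IsStabilizingSolution {m d n l : ℕ} (A : Matrix (Fin m) (Fin m) ℝ)
    (B : Matrix (Fin m) (Fin d) ℝ) (C : Matrix (Fin l) (Fin m) ℝ) (D : Matrix (Fin m) (Fin n) ℝ)
    (R : Matrix (Fin d) (Fin d) ℝ) (γ : ℝ) (K : Matrix (Fin d) (Fin m) ℝ)
    (P : Matrix (Fin m) (Fin m) ℝ) : Prop where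
  posSemidef : P.PosSemidef
  riccati : (A - B * K)ᵀ * P + P * (A - B * K) + Cᵀ * C + Kᵀ * R * K
    + (γ ^ 2)⁻¹ • (P * D * Dᵀ * P) = 0
  hurwitz : IsHurwitz (A - B * K + (γ ^ 2)⁻¹ • (D * Dᵀ * P))

/-- One step of natural policy gradient from `K`, where `P` is the Riccati solution of `K`. -/
def naturalPGStep {m d : ℕ} (B : Matrix (Fin m) (Fin d) ℝ) (R : Matrix (Fin d) (Fin d) ℝ) (η : ℝ)
    (K : Matrix (Fin d) (Fin m) ℝ) (P : Matrix (Fin m) (Fin m) ℝ) : Matrix (Fin d) (Fin m) ℝ :=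
  K - (2 * η) • (R * K - Bᵀ * P)

/-- One step of Gauss-Newton from `K`, where `P` is the Riccati solution of `K`. -/
def gaussNewtonStep {m d : ℕ} (B : Matrix (Fin m) (Fin d) ℝ) (R : Matrix (Fin d) (Fin d) ℝ) (η : ℝ)
    (K : Matrix (Fin d) (Fin m) ℝ) (P : Matrix (Fin m) (Fin m) ℝ) : Matrix (Fin d) (Fin m) ℝ :=
  K - (2 * η) • (K - R⁻¹ * Bᵀ * P)

end MixedDesign

end

/-! Both steps have the form `K' = K - Z * E` with `E = R * K - Bᵀ * P`, where `Z` is `2η` or `2η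
R⁻¹`. The old solution `P` satisfies the Riccati equation of `K'` up to a defect `Eᵀ * N * E`, `N =
Z + Zᵀ - Zᵀ * R * Z`, and the step-size bounds make `N` positive definite. So `P` certifies the new
gain, but only through a non-strict Riccati inequality. Strictness comes from the kernel of the
defect, which is the kernel of `E`: there `K'` and `K` agree, so an eigenvector of the new `F + γ⁻²
D Dᵀ P` in this kernel is one of the old Hurwitz matrix. This is `mem_feasibleSet_of_step`, resting
on `isStable_of_riccati_inequality` and `norm_lt_of_riccati_inequality`.

Existence of stabilizing solutions, for `K` and again for `K'`, is the bounded real lemma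
`exists_riccati_of_norm_lt`. The norm bound excludes imaginary eigenvalues of the Hamiltonian, whose
stable subspace is then the graph of `P`. Isotropy of that subspace makes `P` Hermitian, a Lyapunov
argument makes it positive semidefinite, and uniqueness, a homogeneous Sylvester equation, makes it
real. -/

namespace MixedDesign

/-! ### Stable endomorphisms, Sylvester equations and spectral subspaces. -/

section StableEndomorphisms

variable {V W : Type*} [AddCommGroup V] [Module ℂ V] [AddCommGroup W] [Module ℂ W]

/-- All eigenvalues of the endomorphism have negative real part. -/
def IsStable (f : Module.End ℂ V) : Prop :=
  ∀ (z : ℂ) (v : V), v ≠ 0 → f v = z • v → z.re < 0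

lemma IsStable.bijective_sub_smul [FiniteDimensional ℂ V] {f : Module.End ℂ V} (hf : IsStable f)
    {z : ℂ} (hz : 0 ≤ z.re) : Function.Bijective (f - z • (1 : Module.End ℂ V)) := by
  have hinj : Function.Injective (f - z • (1 : Module.End ℂ V)) := by
    rw [← LinearMap.ker_eq_bot, LinearMap.ker_eq_bot']
    intro v hv
    by_contra hne
    have := hf z v hne (by simpa [sub_eq_zero] using hv)
    linarith
  exact ⟨hinj, LinearMap.injective_iff_surjective.1 hinj⟩

lemma exists_eigenvector [FiniteDimensional ℂ V] [Nontrivial V] (f : Module.End ℂ V) :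
    ∃ (z : ℂ) (v : V), v ≠ 0 ∧ f v = z • v := by
  obtain ⟨z, hz⟩ := Module.End.exists_eigenvalue f
  obtain ⟨v, hv⟩ := hz.exists_hasEigenvector
  exact ⟨z, v, hv.2, hv.apply_eq_smul⟩

/-- An invariant subspace of which every eigenvector vanishes is trivial. -/
lemma eq_bot_of_invariant [FiniteDimensional ℂ V] (f : Module.End ℂ V) (U : Submodule ℂ V)
    (hU : ∀ v ∈ U, f v ∈ U) (h : ∀ z : ℂ, ∀ v ∈ U, f v = z • v → v = 0) : U = ⊥ := by
  by_contra hne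
  have : Nontrivial U := Submodule.nontrivial_iff_ne_bot.2 hne
  obtain ⟨z, v, hv, hz⟩ := exists_eigenvector (f.restrict hU)
  exact hv (Subtype.ext (h z v v.2 (by simpa using congrArg Subtype.val hz)))

/-- The homogeneous Sylvester equation of two stable endomorphisms has only the zero solution. -/
theorem sesquilinear_eq_zero [FiniteDimensional ℂ V] [FiniteDimensional ℂ W]
    {f : Module.End ℂ V} {g : Module.End ℂ W} (hf : IsStable f) (hg : IsStable g)
    (b : V →ₗ⋆[ℂ] W →ₗ[ℂ] ℂ) (hb : ∀ x y, b (f x) y + b x (g y) = 0) (x : V) (y : W) :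
    b x y = 0 := by
  -- The right kernel `N` is `g`-invariant. If it were proper, `g` would have an eigenvector `y`
  -- modulo `N`; both cases below place `y` in `N`.
  let N : Submodule ℂ W := LinearMap.ker b.flip
  have memN : ∀ y, y ∈ N ↔ ∀ x, b x y = 0 := fun y => by
    simp only [N, LinearMap.mem_ker, LinearMap.ext_iff, LinearMap.flip_apply, LinearMap.zero_apply]
  have hgN : N ≤ N.comap g := fun y hy => by
    rw [Submodule.mem_comap, memN]
    intro x
    have h := hb x y
    rwa [(memN y).1 hy, zero_add] at h
  suffices h : N = ⊤ from (memN y).1 (h ▸ Submodule.mem_top) x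
  by_contra hne
  have : Nontrivial (W ⧸ N) := Submodule.Quotient.nontrivial_iff.2 hne
  obtain ⟨z, q, hq, hz⟩ := exists_eigenvector (N.mapQ N g hgN)
  obtain ⟨y, rfl⟩ := N.mkQ_surjective q
  have hy : g y - z • y ∈ N := by
    rw [← Submodule.Quotient.mk_eq_zero, Submodule.Quotient.mk_sub, Submodule.Quotient.mk_smul,
      sub_eq_zero]
    simpa using hz
  apply hq
  rw [Submodule.mkQ_apply, Submodule.Quotient.mk_eq_zero]
  -- If `z.re < 0`, then `b · y` vanishes on the range of `f + conj z`, which is everything.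
  -- Otherwise `g - z` is injective, hence bijective on the invariant space `N`, and `(g - z) y ∈ N`
  -- forces `y ∈ N`.
  rcases lt_or_ge z.re 0 with hre | hre
  · rw [memN]
    intro x
    obtain ⟨w, rfl⟩ := (hf.bijective_sub_smul (z := -(starRingEnd ℂ z)) (by simpa using hre.le)).2 x
    have h1 := (memN _).1 hy w
    have h2 := hb w y
    simp only [map_sub, map_smul, smul_eq_mul] at h1
    simp only [LinearMap.sub_apply, LinearMap.smul_apply, Module.End.one_apply, map_sub,
      LinearMap.map_smulₛₗ, map_neg, RingHomCompTriple.comp_apply, smul_eq_mul]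
    linear_combination h2 - h1
  · have hinj := (hg.bijective_sub_smul hre).1
    have hmaps : ∀ v ∈ N, (g - z • (1 : Module.End ℂ W)) v ∈ N := fun v hv =>
      N.sub_mem (hgN hv) (N.smul_mem z hv)
    have hinjN : Function.Injective ((g - z • (1 : Module.End ℂ W)).restrict hmaps) :=
      fun a c hac => Subtype.ext (hinj (by simpa using congrArg Subtype.val hac))
    have hsurj := LinearMap.injective_iff_surjective.1 hinjN
    obtain ⟨w, hw⟩ := hsurj ⟨_, hy⟩
    have hw' : (g - z • (1 : Module.End ℂ W)) w = (g - z • (1 : Module.End ℂ W)) y := by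
      simpa using congrArg Subtype.val hw
    rw [← hinj hw']
    exact w.2

/-- The sum of the generalized eigenspaces whose eigenvalues lie in `s`. -/
def spectralSubspace (f : Module.End ℂ V) (s : Set ℂ) : Submodule ℂ V :=
  ⨆ z ∈ s, f.maxGenEigenspace z

lemma mapsTo_spectralSubspace (f : Module.End ℂ V) (s : Set ℂ) :
    ∀ v ∈ spectralSubspace f s, f v ∈ spectralSubspace f s := by
  have h : spectralSubspace f s ≤ (spectralSubspace f s).comap f := by
    refine iSup₂_le fun z hz v hv => ?_
    exact (le_iSup₂_of_le (f := fun z (_ : z ∈ s) => f.maxGenEigenspace z) z hz le_rfl)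
      (Module.End.mapsTo_maxGenEigenspace_of_comm (Commute.refl f) z hv)
  exact h

/-- Independence of the generalized eigenspaces: if `z ∉ s`, the one at `z` is disjoint from the sum
over `s`. -/
lemma mem_of_mem_spectralSubspace {f : Module.End ℂ V} {s : Set ℂ} {z : ℂ} {v : V} (hv : v ≠ 0)
    (hs : v ∈ spectralSubspace f s) (hz : f v = z • v) : z ∈ s := by
  by_contra hzs
  have hdisj := f.independent_maxGenEigenspace z
  have hle : spectralSubspace f s ≤ ⨆ w, ⨆ (_ : w ≠ z), f.maxGenEigenspace w :=
    iSup₂_le fun w hw => le_iSup₂_of_le w (by rintro rfl; exact hzs hw) le_rfl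
  have hmem : v ∈ f.maxGenEigenspace z := by
    rw [Module.End.mem_maxGenEigenspace]
    exact ⟨1, by simp [hz]⟩
  exact hv (Submodule.disjoint_def.1 hdisj v hmem (hle hs))

lemma spectralSubspace_sup_compl [FiniteDimensional ℂ V] (f : Module.End ℂ V) (s : Set ℂ) :
    spectralSubspace f s ⊔ spectralSubspace f sᶜ = ⊤ := by
  rw [eq_top_iff, ← f.iSup_maxGenEigenspace_eq_top]
  refine iSup_le fun z => ?_
  by_cases hz : z ∈ s
  · exact le_sup_of_le_left
      (le_iSup₂_of_le (f := fun z (_ : z ∈ s) => f.maxGenEigenspace z) z hz le_rfl)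
  · exact le_sup_of_le_right
      (le_iSup₂_of_le (f := fun z (_ : z ∈ sᶜ) => f.maxGenEigenspace z) z hz le_rfl)

end StableEndomorphisms

/-! ### Stable matrices and the matrix Sylvester equation. -/

section StableMatrices

variable {m : ℕ}

lemma isStable_toLin'_iff (M : Matrix (Fin m) (Fin m) ℂ) :
    IsStable (Matrix.toLin' M) ↔ ∀ z ∈ spectrum ℂ M, z.re < 0 := by
  constructor
  · intro h z hz
    rw [← Matrix.spectrum_toLin', ← Module.End.hasEigenvalue_iff_mem_spectrum] at hz
    obtain ⟨v, hv⟩ := hz.exists_hasEigenvector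
    exact h z v hv.2 hv.apply_eq_smul
  · intro h z v hv hz
    refine h z ?_
    rw [← Matrix.spectrum_toLin', ← Module.End.hasEigenvalue_iff_mem_spectrum]
    exact Module.End.hasEigenvalue_of_hasEigenvector (x := v)
      ⟨Module.End.mem_eigenspace_iff.2 hz, hv⟩

/-- The sesquilinear form `(x, y) ↦ x* M y`. -/
def sesqForm (M : Matrix (Fin m) (Fin m) ℂ) : (Fin m → ℂ) →ₗ⋆[ℂ] (Fin m → ℂ) →ₗ[ℂ] ℂ :=
  LinearMap.mk₂'ₛₗ (starRingEnd ℂ) (RingHom.id ℂ) (fun x y => star x ⬝ᵥ M *ᵥ y)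
    (by intros; simp [add_dotProduct]) (by intros; simp [smul_dotProduct])
    (by intros; simp [Matrix.mulVec_add, dotProduct_add])
    (by intros; simp [Matrix.mulVec_smul, dotProduct_smul])

@[simp]
lemma sesqForm_apply (M : Matrix (Fin m) (Fin m) ℂ) (x y : Fin m → ℂ) :
    sesqForm M x y = star x ⬝ᵥ M *ᵥ y := rfl

lemma star_mulVec_dotProduct {p q : ℕ} (M : Matrix (Fin p) (Fin q) ℂ) (x : Fin q → ℂ)
    (y : Fin p → ℂ) : star (M *ᵥ x) ⬝ᵥ y = star x ⬝ᵥ Mᴴ *ᵥ y := by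
  rw [Matrix.star_mulVec, ← Matrix.dotProduct_mulVec]

theorem sylvester_eq_zero {M N X : Matrix (Fin m) (Fin m) ℂ} (hM : IsStable (Matrix.toLin' M))
    (hN : IsStable (Matrix.toLin' N)) (h : Mᴴ * X + X * N = 0) : X = 0 := by
  have key := sesquilinear_eq_zero hM hN (sesqForm X) (fun x y => by
    simp only [sesqForm_apply, Matrix.toLin'_apply, star_mulVec_dotProduct, Matrix.mulVec_mulVec]
    rw [← dotProduct_add, ← Matrix.add_mulVec, h]
    simp)
  refine Matrix.ext_of_mulVec_single fun j => ?_
  ext i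
  simpa using key (Pi.single i 1) (Pi.single j 1)

end StableMatrices

/-! ### The Lyapunov equation via the Cayley transform. -/

section Lyapunov

open scoped ComplexOrder
open Filter Topology

variable {m : ℕ}

/-- Gelfand's formula: for `r` between the spectral radius and 1, eventually `‖U ^ n‖ ≤ r ^ n`. -/
lemma tendsto_pow_zero_of_norm_lt_one (U : Matrix (Fin m) (Fin m) ℂ)
    (hU : ∀ z ∈ spectrum ℂ U, ‖z‖ < 1) : Tendsto (fun n => U ^ n) atTop (𝓝 0) := by
  have : CompleteSpace (Matrix (Fin m) (Fin m) ℂ) := FiniteDimensional.complete ℂ _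
  rcases subsingleton_or_nontrivial (Matrix (Fin m) (Fin m) ℂ) with hs | hs
  · exact tendsto_const_nhds.congr fun n => Subsingleton.elim _ _
  have hr : spectralRadius ℂ U < ((1 : NNReal) : ENNReal) :=
    spectrum.spectralRadius_lt_of_forall_lt U fun z hz => by
      rw [← NNReal.coe_lt_coe]; simpa using hU z hz
  obtain ⟨r, hr0, hr1⟩ := ENNReal.lt_iff_exists_nnreal_btwn.1 hr
  have hev := (spectrum.pow_nnnorm_pow_one_div_tendsto_nhds_spectralRadius U).eventually_lt_const hr0
  rw [tendsto_zero_iff_norm_tendsto_zero]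
  have hr1' : r < 1 := by exact_mod_cast hr1
  refine squeeze_zero' (Eventually.of_forall fun n => norm_nonneg _) ?_
    (tendsto_pow_atTop_nhds_zero_of_lt_one r.2 (show (r : ℝ) < 1 by exact_mod_cast hr1'))
  filter_upwards [hev, eventually_gt_atTop 0] with n hn hn0
  have h1 : (‖U ^ n‖₊ : ENNReal) ≤ (r : ENNReal) ^ n := by
    have h2 := ENNReal.rpow_le_rpow hn.le (Nat.cast_nonneg (α := ℝ) n)
    rwa [← ENNReal.rpow_mul, one_div, inv_mul_cancel₀ (by exact_mod_cast hn0.ne'),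
      ENNReal.rpow_one, ENNReal.rpow_natCast] at h2
  exact_mod_cast h1

/-- A Hermitian solution of the Lyapunov equation of a stable matrix is positive semidefinite. -/
theorem posSemidef_of_lyapunov {F P N : Matrix (Fin m) (Fin m) ℂ}
    (hF : IsStable (Matrix.toLin' F)) (hP : P.IsHermitian) (hN : N.PosSemidef)
    (h : Fᴴ * P + P * F + N = 0) : P.PosSemidef := by
  have hdet : IsUnit (1 - F) := by
    rw [← Matrix.mulVec_injective_iff_isUnit]
    intro x y hxy
    rw [← sub_eq_zero]
    by_contra hne
    have hz := hF 1 (x - y) hne (by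
      have h1 : (1 - F) *ᵥ (x - y) = 0 := by rw [Matrix.mulVec_sub, hxy, sub_self]
      rw [Matrix.sub_mulVec, Matrix.one_mulVec, sub_eq_zero] at h1
      rw [Matrix.toLin'_apply, ← h1, one_smul])
    norm_num at hz
  have hinv : (1 - F) * (1 - F)⁻¹ = 1 :=
    Matrix.mul_nonsing_inv _ ((Matrix.isUnit_iff_isUnit_det _).1 hdet)
  -- The Cayley transform sends the left half plane to the unit disc. The form of `P` does not
  -- increase under `U`, and `U ^ n` tends to zero, so its value at `x` is at least its limit 0.
  set U := (1 + F) * (1 - F)⁻¹ with hUdef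
  have hsurj : ∀ x, ∃ w, x = (1 - F) *ᵥ w ∧ U *ᵥ x = (1 + F) *ᵥ w := fun x =>
    ⟨(1 - F)⁻¹ *ᵥ x, by rw [Matrix.mulVec_mulVec, hinv, Matrix.one_mulVec],
      by rw [hUdef, Matrix.mulVec_mulVec]⟩
  have hUs : ∀ z ∈ spectrum ℂ U, ‖z‖ < 1 := by
    intro z hz
    rw [← Matrix.spectrum_toLin', ← Module.End.hasEigenvalue_iff_mem_spectrum] at hz
    obtain ⟨x, hx⟩ := hz.exists_hasEigenvector
    obtain ⟨w, hw, hUw⟩ := hsurj x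
    have hx0 := hx.2
    have hxe : U *ᵥ x = z • x := by simpa using hx.apply_eq_smul
    have hw0 : w ≠ 0 := by rintro rfl; exact hx0 (by simpa using hw)
    rw [hUw, hw, Matrix.add_mulVec, Matrix.sub_mulVec, Matrix.one_mulVec] at hxe
    have hxe' : (z + 1) • F *ᵥ w = (z - 1) • w := by
      rw [add_smul, sub_smul, one_smul, one_smul]
      rw [smul_sub] at hxe
      linear_combination (exp := 1) hxe
    have hz1 : z + 1 ≠ 0 := by
      intro hz1
      rw [hz1, zero_smul, eq_comm, smul_eq_zero] at hxe'
      rcases hxe' with h1 | h1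
      · have : (2 : ℂ) = 0 := by linear_combination hz1 - h1
        norm_num at this
      · exact hw0 h1
    have hre := hF ((z - 1) / (z + 1)) w hw0 (by
      rw [Matrix.toLin'_apply, div_eq_inv_mul, mul_smul, ← hxe', smul_smul, inv_mul_cancel₀ hz1,
        one_smul])
    have hpos : 0 < Complex.normSq (z + 1) := Complex.normSq_pos.2 hz1
    rw [Complex.div_re, ← add_div, div_lt_iff₀ hpos, zero_mul] at hre
    simp only [Complex.sub_re, Complex.add_re, Complex.one_re, Complex.sub_im, Complex.add_im,
      Complex.one_im] at hre
    have h2 : ‖z‖ ^ 2 < 1 := by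
      rw [← Complex.normSq_eq_norm_sq, Complex.normSq_apply]
      nlinarith
    nlinarith [norm_nonneg z]
  let q : (Fin m → ℂ) → ℂ := fun x => star x ⬝ᵥ P *ᵥ x
  have hstep : ∀ x, q (U *ᵥ x) ≤ q x := by
    intro x
    obtain ⟨w, hw, hUw⟩ := hsurj x
    have hNw := hN.dotProduct_mulVec_nonneg w
    have hN' : N = -(Fᴴ * P + P * F) := by rw [eq_neg_iff_add_eq_zero, add_comm, h]
    have hq : q x - q (U *ᵥ x) = 2 * (star w ⬝ᵥ N *ᵥ w) := by
      simp only [q]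
      rw [hUw, hw, hN']
      simp only [Matrix.sub_mulVec, Matrix.add_mulVec, Matrix.one_mulVec, Matrix.mulVec_sub,
        Matrix.mulVec_add, star_sub, star_add, sub_dotProduct, add_dotProduct, dotProduct_sub,
        dotProduct_add, star_mulVec_dotProduct, Matrix.mulVec_mulVec, Matrix.neg_mulVec,
        dotProduct_neg]
      ring
    rw [← sub_nonneg, hq]
    exact mul_nonneg (by norm_num) hNw
  refine Matrix.PosSemidef.of_dotProduct_mulVec_nonneg hP fun x => ?_
  have hanti : ∀ n : ℕ, q ((U ^ n) *ᵥ x) ≤ q x := by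
    intro n
    induction n with
    | zero => simp
    | succ k ih =>
      rw [pow_succ', ← Matrix.mulVec_mulVec]
      exact (hstep _).trans ih
  have hlim : Tendsto (fun n : ℕ => q ((U ^ n) *ᵥ x)) atTop (𝓝 (q ((0 : Matrix _ _ ℂ) *ᵥ x))) := by
    have hc : Continuous fun M : Matrix (Fin m) (Fin m) ℂ => q (M *ᵥ x) := by
      simp only [q]
      fun_prop
    exact (hc.tendsto 0).comp (tendsto_pow_zero_of_norm_lt_one U hUs)
  have h0 : q ((0 : Matrix _ _ ℂ) *ᵥ x) = 0 := by simp [q]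
  rw [h0] at hlim
  exact le_of_tendsto hlim (Eventually.of_forall hanti)

end Lyapunov

/-! ### Hamiltonian maps and isotropic invariant subspaces. -/

section Hamiltonian

open scoped ComplexOrder

variable {m : ℕ}

/-- The Hamiltonian map `(x, y) ↦ (F x + S y, -Q x - F* y)` of a Riccati equation. -/
def hamiltonian (F S Q : Matrix (Fin m) (Fin m) ℂ) :
    Module.End ℂ ((Fin m → ℂ) × (Fin m → ℂ)) :=
  (F.mulVecLin.coprod S.mulVecLin).prod ((-Q).mulVecLin.coprod (-Fᴴ).mulVecLin)

@[simp]
lemma hamiltonian_apply (F S Q : Matrix (Fin m) (Fin m) ℂ) (v : (Fin m → ℂ) × (Fin m → ℂ)) :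
    hamiltonian F S Q v = (F *ᵥ v.1 + S *ᵥ v.2, -(Q *ᵥ v.1) - Fᴴ *ᵥ v.2) := by
  simp [hamiltonian, sub_eq_add_neg]

/-- The standard skew-Hermitian form `x₁* y₂ - x₂* y₁`. -/
def symplecticForm (m : ℕ) : ((Fin m → ℂ) × (Fin m → ℂ)) →ₗ⋆[ℂ]
    ((Fin m → ℂ) × (Fin m → ℂ)) →ₗ[ℂ] ℂ :=
  LinearMap.mk₂'ₛₗ (starRingEnd ℂ) (RingHom.id ℂ)
    (fun x y => star x.1 ⬝ᵥ y.2 - star x.2 ⬝ᵥ y.1)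
    (by intros; simp [add_dotProduct]; ring)
    (by intros; simp [smul_dotProduct, mul_sub])
    (by intros; simp [dotProduct_add]; ring)
    (by intros; simp [dotProduct_smul, mul_sub])

@[simp]
lemma symplecticForm_apply (x y : (Fin m → ℂ) × (Fin m → ℂ)) :
    symplecticForm m x y = star x.1 ⬝ᵥ y.2 - star x.2 ⬝ᵥ y.1 := rfl

/-- Skewness of the Hamiltonian is the hypothesis of `sesquilinear_eq_zero` for the form restricted
to an invariant subspace. -/
lemma symplecticForm_hamiltonian {F S Q : Matrix (Fin m) (Fin m) ℂ} (hS : S.IsHermitian)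
    (hQ : Q.IsHermitian) (x y : (Fin m → ℂ) × (Fin m → ℂ)) :
    symplecticForm m (hamiltonian F S Q x) y + symplecticForm m x (hamiltonian F S Q y) = 0 := by
  simp only [symplecticForm_apply, hamiltonian_apply, star_add, star_sub, star_neg,
    add_dotProduct, sub_dotProduct, neg_dotProduct, star_mulVec_dotProduct, dotProduct_add,
    dotProduct_sub, dotProduct_neg, hS.eq, hQ.eq, Matrix.conjTranspose_conjTranspose]
  ring

/-- An invariant subspace on which the Hamiltonian or its negative is stable is isotropic. -/
lemma isotropic_of_isStable {F S Q : Matrix (Fin m) (Fin m) ℂ} (hS : S.IsHermitian)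
    (hQ : Q.IsHermitian) {U : Submodule ℂ ((Fin m → ℂ) × (Fin m → ℂ))}
    (hU : ∀ v ∈ U, hamiltonian F S Q v ∈ U)
    (hst : (∀ z : ℂ, ∀ v ∈ U, v ≠ 0 → hamiltonian F S Q v = z • v → z.re < 0) ∨
      (∀ z : ℂ, ∀ v ∈ U, v ≠ 0 → hamiltonian F S Q v = z • v → 0 < z.re)) :
    ∀ x ∈ U, ∀ y ∈ U, symplecticForm m x y = 0 := by
  intro x hx y hy
  let b : U →ₗ⋆[ℂ] U →ₗ[ℂ] ℂ := (symplecticForm m).domRestrict₁₂ U U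
  have hb : ∀ x y : U, b ((hamiltonian F S Q).restrict hU x) y
      + b x ((hamiltonian F S Q).restrict hU y) = 0 := fun x y =>
    symplecticForm_hamiltonian hS hQ x y
  rcases hst with hst | hst
  · have hs : IsStable ((hamiltonian F S Q).restrict hU) := fun z v hv hz =>
      hst z v v.2 (by simpa using hv) (congrArg Subtype.val hz)
    exact sesquilinear_eq_zero hs hs b hb ⟨x, hx⟩ ⟨y, hy⟩
  · have hs : IsStable (-((hamiltonian F S Q).restrict hU)) := fun z v hv hz => by
      have h1 : hamiltonian F S Q v = (-z) • (v : (Fin m → ℂ) × (Fin m → ℂ)) := by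
        have h2 := congrArg Subtype.val hz
        rw [neg_smul, ← neg_eq_iff_eq_neg]
        exact h2
      have := hst (-z) v v.2 (by simpa using hv) h1
      simpa using this
    refine sesquilinear_eq_zero hs hs b (fun x y => ?_) ⟨x, hx⟩ ⟨y, hy⟩
    have := hb x y
    simp only [LinearMap.neg_apply, map_neg]
    rw [← neg_add, this, neg_zero]

end Hamiltonian

/-! ### Existence and uniqueness of stabilizing Riccati solutions. -/

section RiccatiExistence

open scoped ComplexOrder

variable {m : ℕ}

lemma mulVec_eq_zero_of_isotropic {S : Matrix (Fin m) (Fin m) ℂ} (hS : S.PosSemidef)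
    {y : Fin m → ℂ} (h : star y ⬝ᵥ S *ᵥ y = 0) : S *ᵥ y = 0 :=
  (hS.dotProduct_mulVec_zero_iff y).1 h

/-- If `z.re ≤ 0`, then `F + conj z` is surjective, so `y = (F + conj z) x` and `y* y = x* (F* + z)
y = 0`. -/
lemma IsStable.re_pos_of_neg_conjTranspose {F : Matrix (Fin m) (Fin m) ℂ}
    (hF : IsStable (Matrix.toLin' F)) {z : ℂ} {y : Fin m → ℂ} (hy : y ≠ 0)
    (h : -(Fᴴ *ᵥ y) = z • y) : 0 < z.re := by
  by_contra hz
  push Not at hz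
  have hbij := hF.bijective_sub_smul (z := -(starRingEnd ℂ z)) (by simpa using hz)
  obtain ⟨x, hx⟩ := hbij.2 y
  have hx' : y = F *ᵥ x + (starRingEnd ℂ z) • x := by
    rw [← hx]
    simp [sub_eq_add_neg]
  apply hy
  rw [← dotProduct_star_self_eq_zero]
  nth_rewrite 1 [hx']
  rw [star_add, add_dotProduct, star_mulVec_dotProduct, neg_eq_iff_eq_neg.1 h]
  simp

/-- The stable subspace of the Hamiltonian meets `0 × ℂᵐ` trivially. -/
lemma stable_subspace_injective_fst {F S Q : Matrix (Fin m) (Fin m) ℂ}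
    (hF : IsStable (Matrix.toLin' F)) (hS : S.PosSemidef)
    {U : Submodule ℂ ((Fin m → ℂ) × (Fin m → ℂ))} (hU : ∀ v ∈ U, hamiltonian F S Q v ∈ U)
    (hst : ∀ z : ℂ, ∀ v ∈ U, v ≠ 0 → hamiltonian F S Q v = z • v → z.re < 0)
    (hiso : ∀ x ∈ U, ∀ y ∈ U, symplecticForm m x y = 0) :
    Function.Injective ((LinearMap.fst ℂ (Fin m → ℂ) (Fin m → ℂ)).comp U.subtype) := by
  -- Pairing `(0, y)` with its image gives `y* S y = 0`. Hence these `y` form a `-F*`-invariant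
  -- space, whose eigenvalues would need real parts of both signs.
  have hSy : ∀ y, ((0, y) : (Fin m → ℂ) × (Fin m → ℂ)) ∈ U → S *ᵥ y = 0 := fun y hy => by
    refine mulVec_eq_zero_of_isotropic hS ?_
    have := hiso _ hy _ (hU _ hy)
    simpa using this
  have hbot : U.comap (LinearMap.inr ℂ (Fin m → ℂ) (Fin m → ℂ)) = ⊥ := by
    refine eq_bot_of_invariant (-Fᴴ).mulVecLin _ (fun y hy => ?_) (fun z y hy hz => ?_)
    · have h1 := hU _ hy
      rw [LinearMap.inr_apply, hamiltonian_apply, hSy y hy] at h1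
      change ((0, (-Fᴴ) *ᵥ y) : (Fin m → ℂ) × (Fin m → ℂ)) ∈ U
      rw [Matrix.neg_mulVec]
      simpa using h1
    · by_contra hne
      have h1 : -(Fᴴ *ᵥ y) = z • y := by simpa [Matrix.neg_mulVec] using hz
      have h2 := hF.re_pos_of_neg_conjTranspose hne h1
      have h3 := hst z (0, y) hy (by simpa using hne) (by
        rw [hamiltonian_apply, hSy y hy]
        simp [h1])
      linarith
  rw [← LinearMap.ker_eq_bot, LinearMap.ker_eq_bot']
  rintro ⟨⟨x, y⟩, hv⟩ h
  have hx : x = 0 := h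
  subst hx
  have : y ∈ U.comap (LinearMap.inr ℂ (Fin m → ℂ) (Fin m → ℂ)) := hv
  rw [hbot, Submodule.mem_bot] at this
  simp [this]

/-- The antistable subspace of the Hamiltonian meets `ℂᵐ × 0` trivially. -/
lemma antistable_subspace_injective_snd {F S Q : Matrix (Fin m) (Fin m) ℂ}
    (hF : IsStable (Matrix.toLin' F)) (hQ : Q.PosSemidef)
    {U : Submodule ℂ ((Fin m → ℂ) × (Fin m → ℂ))} (hU : ∀ v ∈ U, hamiltonian F S Q v ∈ U)
    (hst : ∀ z : ℂ, ∀ v ∈ U, v ≠ 0 → hamiltonian F S Q v = z • v → 0 < z.re)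
    (hiso : ∀ x ∈ U, ∀ y ∈ U, symplecticForm m x y = 0) :
    Function.Injective ((LinearMap.snd ℂ (Fin m → ℂ) (Fin m → ℂ)).comp U.subtype) := by
  have hQx : ∀ x, ((x, 0) : (Fin m → ℂ) × (Fin m → ℂ)) ∈ U → Q *ᵥ x = 0 := fun x hx => by
    refine mulVec_eq_zero_of_isotropic hQ ?_
    have := hiso _ hx _ (hU _ hx)
    simpa using this
  have hbot : U.comap (LinearMap.inl ℂ (Fin m → ℂ) (Fin m → ℂ)) = ⊥ := by
    refine eq_bot_of_invariant (Matrix.toLin' F) _ (fun x hx => ?_) (fun z x hx hz => ?_)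
    · have h1 := hU _ hx
      rw [LinearMap.inl_apply, hamiltonian_apply, hQx x hx] at h1
      simpa [Submodule.mem_comap] using h1
    · by_contra hne
      have h2 := hF z x hne hz
      have h3 := hst z (x, 0) hx (by simpa using hne) (by
        rw [hamiltonian_apply, hQx x hx]
        simpa using hz)
      linarith
  rw [← LinearMap.ker_eq_bot, LinearMap.ker_eq_bot']
  rintro ⟨⟨x, y⟩, hv⟩ h
  have hy : y = 0 := h
  subst hy
  have : x ∈ U.comap (LinearMap.inl ℂ (Fin m → ℂ) (Fin m → ℂ)) := hv
  rw [hbot, Submodule.mem_bot] at this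
  simp [this]

/-- If `F` is stable and the Hamiltonian has no imaginary eigenvalue, then the Riccati equation has
a stabilizing solution, and it is positive semidefinite. -/
theorem exists_stabilizing_riccati {F S Q : Matrix (Fin m) (Fin m) ℂ}
    (hF : IsStable (Matrix.toLin' F)) (hS : S.PosSemidef) (hQ : Q.PosSemidef)
    (hH : ∀ (z : ℂ) (v : (Fin m → ℂ) × (Fin m → ℂ)), v ≠ 0 → hamiltonian F S Q v = z • v →
      z.re ≠ 0) :
    ∃ P : Matrix (Fin m) (Fin m) ℂ, P.PosSemidef ∧ Fᴴ * P + P * F + Q + P * S * P = 0 ∧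
      IsStable (Matrix.toLin' (F + S * P)) := by
  set H := hamiltonian F S Q with hHdef
  let s : Set ℂ := {z | z.re < 0}
  let U := spectralSubspace H s
  let U' := spectralSubspace H sᶜ
  have hU : ∀ v ∈ U, H v ∈ U := mapsTo_spectralSubspace H s
  have hU' : ∀ v ∈ U', H v ∈ U' := mapsTo_spectralSubspace H sᶜ
  have hst : ∀ z : ℂ, ∀ v ∈ U, v ≠ 0 → H v = z • v → z.re < 0 := fun z v hv h0 hz =>
    mem_of_mem_spectralSubspace h0 hv hz
  have hst' : ∀ z : ℂ, ∀ v ∈ U', v ≠ 0 → H v = z • v → 0 < z.re := fun z v hv h0 hz =>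
    lt_of_le_of_ne (not_lt.1 (mem_of_mem_spectralSubspace h0 hv hz)) (hH z v h0 hz).symm
  have hiso := isotropic_of_isStable hS.1 hQ.1 hU (Or.inl hst)
  have hiso' := isotropic_of_isStable hS.1 hQ.1 hU' (Or.inr hst')
  have hinj := stable_subspace_injective_fst hF hS hU hst hiso
  have hinj' := antistable_subspace_injective_snd hF hQ hU' hst' hiso'
  -- Each spectral subspace has dimension at most `m` and together they span `2m` dimensions, so the
  -- stable one has dimension exactly `m` and is a graph.
  have hd' := LinearMap.finrank_le_finrank_of_injective hinj'
  have hd := LinearMap.finrank_le_finrank_of_injective hinj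
  have hsup : U ⊔ U' = ⊤ := spectralSubspace_sup_compl H s
  have hsum := Submodule.finrank_add_le_finrank_add_finrank U U'
  rw [hsup, finrank_top, Module.finrank_prod, Module.finrank_fin_fun] at hsum
  rw [Module.finrank_fin_fun] at hd hd'
  have hdim : Module.finrank ℂ U = Module.finrank ℂ (Fin m → ℂ) := by
    rw [Module.finrank_fin_fun]
    omega
  let e := LinearEquiv.ofInjectiveOfFinrankEq _ hinj hdim
  have he : ∀ v : U, e v = (v : (Fin m → ℂ) × (Fin m → ℂ)).1 := fun v => rfl
  let p : (Fin m → ℂ) →ₗ[ℂ] (Fin m → ℂ) :=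
    (LinearMap.snd ℂ (Fin m → ℂ) (Fin m → ℂ)).comp (U.subtype.comp e.symm.toLinearMap)
  let P := LinearMap.toMatrix' p
  have hmem : ∀ x, ((x, P *ᵥ x) : (Fin m → ℂ) × (Fin m → ℂ)) ∈ U := fun x => by
    have h1 : ((x, P *ᵥ x) : (Fin m → ℂ) × (Fin m → ℂ)) = (e.symm x : U) := by
      refine Prod.ext ?_ ?_
      · change x = _
        rw [← he, e.apply_symm_apply]
      · change P *ᵥ x = _
        rw [LinearMap.toMatrix'_mulVec]
        rfl
    rw [h1]
    exact Subtype.mem _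
  have hgraph : ∀ x y, ((x, y) : (Fin m → ℂ) × (Fin m → ℂ)) ∈ U → y = P *ᵥ x := fun x y hxy => by
    have := hinj (a₁ := ⟨_, hxy⟩) (a₂ := ⟨_, hmem x⟩) rfl
    exact congrArg (fun v : U => (v : (Fin m → ℂ) × (Fin m → ℂ)).2) this
  have hP : P.IsHermitian := by
    ext i j
    have h1 := hiso _ (hmem (Pi.single i 1)) _ (hmem (Pi.single j 1))
    rw [symplecticForm_apply, star_mulVec_dotProduct, sub_eq_zero] at h1
    simpa using h1.symm
  have hric : ∀ x, -(Q *ᵥ x) - Fᴴ *ᵥ (P *ᵥ x) = P *ᵥ (F *ᵥ x + S *ᵥ (P *ᵥ x)) := fun x => by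
    have h1 := hU _ (hmem x)
    rw [hHdef, hamiltonian_apply] at h1
    exact hgraph _ _ h1
  have hric' : Fᴴ * P + P * F + Q + P * S * P = 0 := by
    refine Matrix.ext_of_mulVec_single fun j => ?_
    have h1 := hric (Pi.single j 1)
    rw [Matrix.mulVec_add] at h1
    simp only [Matrix.add_mulVec, Matrix.zero_mulVec, ← Matrix.mulVec_mulVec]
    linear_combination (exp := 1) -h1
  refine ⟨P, ?_, hric', fun z x hx hz => ?_⟩
  -- The Riccati equation read as a Lyapunov equation for `F`, its quadratic term moved into the
  -- source.
  · refine posSemidef_of_lyapunov (N := Q + P * S * P) hF hP (hQ.add ?_) (by rw [← hric']; abel)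
    have := hS.conjTranspose_mul_mul_same P
    rwa [hP.eq] at this
  · rw [Matrix.toLin'_apply, Matrix.add_mulVec, ← Matrix.mulVec_mulVec] at hz
    refine hst z (x, P *ᵥ x) (hmem x) (by simp [hx]) ?_
    rw [hHdef, hamiltonian_apply]
    refine Prod.ext hz ?_
    change -(Q *ᵥ x) - Fᴴ *ᵥ (P *ᵥ x) = z • (P *ᵥ x)
    rw [hric, hz, Matrix.mulVec_smul]

/-- Two Hermitian stabilizing solutions of a Riccati equation agree. -/
theorem stabilizing_riccati_unique {F S Q P P' : Matrix (Fin m) (Fin m) ℂ}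
    (hS : S.IsHermitian) (hP : P.IsHermitian)
    (h : Fᴴ * P + P * F + Q + P * S * P = 0) (h' : Fᴴ * P' + P' * F + Q + P' * S * P' = 0)
    (hst : IsStable (Matrix.toLin' (F + S * P))) (hst' : IsStable (Matrix.toLin' (F + S * P'))) :
    P = P' := by
  rw [← sub_eq_zero]
  -- The difference of the two equations factors as `(F + S P)* (P - P') + (P - P') (F + S P') = 0`.
  refine sylvester_eq_zero hst hst' ?_
  rw [Matrix.conjTranspose_add, Matrix.conjTranspose_mul, hS.eq, hP.eq, ← sub_self (0 : Matrix _ _ ℂ)]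
  nth_rewrite 1 [← h]
  rw [← h']
  noncomm_ring

end RiccatiExistence

/-! ### Frequency responses and the `H∞` norm. -/

section FrequencyDomain

open scoped ComplexOrder
open Filter Topology

variable {m n p : ℕ}

lemma star_dotProduct_self_eq_norm_sq (u : Fin n → ℂ) :
    star u ⬝ᵥ u = ((‖WithLp.toLp 2 u‖ ^ 2 : ℝ) : ℂ) := by
  rw [dotProduct_comm, Complex.ofReal_pow]
  exact inner_self_eq_norm_sq_to_K (𝕜 := ℂ) (WithLp.toLp 2 u)

lemma star_mulVec_dotProduct_mulVec_lt {T : Matrix (Fin p) (Fin n) ℂ} {γ : ℝ} (hT : ‖T‖ < γ)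
    {u : Fin n → ℂ} (hu : u ≠ 0) :
    (star (T *ᵥ u) ⬝ᵥ T *ᵥ u).re < γ ^ 2 * (star u ⬝ᵥ u).re := by
  rw [star_dotProduct_self_eq_norm_sq, star_dotProduct_self_eq_norm_sq, Complex.ofReal_re,
    Complex.ofReal_re, ← mul_pow]
  have hpos : 0 < ‖WithLp.toLp 2 u‖ := norm_pos_iff.2 (by simpa using hu)
  have h1 := Matrix.l2_opNorm_mulVec T (WithLp.toLp 2 u)
  refine pow_lt_pow_left₀ (lt_of_le_of_lt h1 ?_) (norm_nonneg _) two_ne_zero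
  exact mul_lt_mul_of_pos_right hT hpos

/-- Strictness survives the supremum since the unit sphere is compact. For `n = 0` the sphere is
empty and `0 < γ` decides. -/
lemma l2_opNorm_lt_of_forall {T : Matrix (Fin p) (Fin n) ℂ} {γ : ℝ} (hγ : 0 < γ)
    (h : ∀ u : Fin n → ℂ, u ≠ 0 →
      (star (T *ᵥ u) ⬝ᵥ T *ᵥ u).re < γ ^ 2 * (star u ⬝ᵥ u).re) : ‖T‖ < γ := by
  let L : EuclideanSpace ℂ (Fin n) →L[ℂ] EuclideanSpace ℂ (Fin p) :=
    LinearMap.toContinuousLinearMap (Matrix.toEuclideanLin T)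
  have hL : ∀ u, ‖L u‖ ≤ γ * ‖u‖ ∧ (u ≠ 0 → ‖L u‖ < γ * ‖u‖) := by
    have hlt : ∀ u, u ≠ 0 → ‖L u‖ < γ * ‖u‖ := fun u hu => by
      have h1 := h u.ofLp (by simpa using hu)
      rw [star_dotProduct_self_eq_norm_sq, star_dotProduct_self_eq_norm_sq, Complex.ofReal_re,
        Complex.ofReal_re, ← mul_pow] at h1
      exact lt_of_pow_lt_pow_left₀ 2 (by positivity) h1
    refine fun u => ⟨?_, hlt u⟩
    rcases eq_or_ne u 0 with rfl | hu
    · simp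
    · exact (hlt u hu).le
  have hTL : ‖T‖ = ‖L‖ := rfl
  rw [hTL]
  rcases (Metric.sphere (0 : EuclideanSpace ℂ (Fin n)) 1).eq_empty_or_nonempty with he | hne
  · have hL0 : L = 0 := by
      ext1 u
      by_contra hu
      have hu0 : u ≠ 0 := by rintro rfl; simp at hu
      have : ((‖u‖⁻¹ : ℝ) : ℂ) • u ∈ Metric.sphere (0 : EuclideanSpace ℂ (Fin n)) 1 := by
        simp [norm_smul, inv_mul_cancel₀ (norm_ne_zero_iff.2 hu0)]
      rw [he] at this
      exact this
    rwa [hL0, norm_zero]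
  · obtain ⟨v, hv, hmax⟩ := (isCompact_sphere (0 : EuclideanSpace ℂ (Fin n)) 1).exists_isMaxOn hne
      L.continuous.norm.continuousOn
    have hv1 : ‖v‖ = 1 := by simpa using hv
    have hlt := (hL v).2 (by rintro rfl; simp at hv1)
    rw [hv1, mul_one] at hlt
    refine lt_of_le_of_lt (ContinuousLinearMap.opNorm_le_of_unit_norm (norm_nonneg _) ?_) hlt
    exact fun u hu => hmax (by simpa using hu)

/-- The complexification of a real matrix. -/
abbrev toComplex {p q : ℕ} (M : Matrix (Fin p) (Fin q) ℝ) : Matrix (Fin p) (Fin q) ℂ :=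
  M.map Complex.ofReal

lemma isHurwitz_iff_isStable (M : Matrix (Fin m) (Fin m) ℝ) :
    IsHurwitz M ↔ IsStable (Matrix.toLin' (toComplex M)) :=
  (isStable_toLin'_iff _).symm

lemma IsStable.isUnit_smul_one_sub {F : Matrix (Fin m) (Fin m) ℂ}
    (hF : IsStable (Matrix.toLin' F)) {z : ℂ} (hz : 0 ≤ z.re) :
    IsUnit (z • (1 : Matrix (Fin m) (Fin m) ℂ) - F) := by
  rw [← IsUnit.neg_iff, neg_sub, ← Matrix.mulVec_injective_iff_isUnit]
  convert (hF.bijective_sub_smul hz).1 using 1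
  ext x i
  simp [Matrix.sub_mulVec, Matrix.smul_mulVec]

lemma I_mul_ofReal_re (ω : ℝ) : (Complex.I * (ω : ℂ)).re = 0 := by simp

/-- A stable system driven at frequency `ω` has the state `x` with `iω x = F x + G u`. -/
lemma exists_state {F : Matrix (Fin m) (Fin m) ℝ} (hF : IsHurwitz F)
    (G : Matrix (Fin m) (Fin n) ℝ) (H : Matrix (Fin p) (Fin m) ℝ) (ω : ℝ) (u : Fin n → ℂ) :
    ∃ x, toComplex F *ᵥ x + toComplex G *ᵥ u = (Complex.I * ω) • x ∧
      transferFunction F G H (Complex.I * ω) *ᵥ u = toComplex H *ᵥ x := by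
  have hu := ((isHurwitz_iff_isStable F).1 hF).isUnit_smul_one_sub (I_mul_ofReal_re ω).ge
  refine ⟨((Complex.I * ω) • (1 : Matrix (Fin m) (Fin m) ℂ) - toComplex F)⁻¹ *ᵥ
    (toComplex G *ᵥ u), ?_, by simp [transferFunction, Matrix.mulVec_mulVec, Matrix.mul_assoc]⟩
  have h1 := Matrix.mul_nonsing_inv _ ((Matrix.isUnit_iff_isUnit_det _).1 hu)
  have h2 := congrArg (fun M => M *ᵥ (toComplex G *ᵥ u)) h1
  simp only [← Matrix.mulVec_mulVec, Matrix.one_mulVec, Matrix.sub_mulVec, Matrix.smul_mulVec] at h2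
  simp only [Matrix.mulVec_mulVec] at h2 ⊢
  linear_combination (exp := 1) -h2

lemma state_unique {F : Matrix (Fin m) (Fin m) ℂ} (hF : IsStable (Matrix.toLin' F)) {z : ℂ}
    (hz : 0 ≤ z.re) {x y w : Fin m → ℂ} (hx : F *ᵥ x + w = z • x) (hy : F *ᵥ y + w = z • y) :
    x = y := by
  refine (hF.bijective_sub_smul hz).1 ?_
  simp only [LinearMap.sub_apply, LinearMap.smul_apply, Module.End.one_apply, Matrix.toLin'_apply]
  linear_combination (exp := 1) hx - hy

/-- The response is continuous along the imaginary axis and vanishes at infinity, so strict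
pointwise bounds give a strict bound on the supremum. -/
lemma hInftyNorm_lt_of_forall {F : Matrix (Fin m) (Fin m) ℝ} (hF : IsHurwitz F)
    (G : Matrix (Fin m) (Fin n) ℝ) (H : Matrix (Fin p) (Fin m) ℝ) {γ : ℝ} (hγ : 0 < γ)
    (h : ∀ ω : ℝ, ‖transferFunction F G H (Complex.I * ω)‖ < γ) :
    hInftyNorm (transferFunction F G H) < ENNReal.ofReal γ := by
  have : CompleteSpace (Matrix (Fin m) (Fin m) ℂ) := FiniteDimensional.complete ℂ _
  have hst := (isHurwitz_iff_isStable F).1 hF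
  have htf : ∀ ω : ℝ, transferFunction F G H (Complex.I * ω) =
      toComplex H * resolvent (toComplex F) (Complex.I * (ω : ℂ)) * toComplex G := fun ω => by
    rw [transferFunction, resolvent, Matrix.nonsing_inv_eq_ringInverse, Algebra.algebraMap_eq_smul_one]
  have hmul : Continuous fun M : Matrix (Fin m) (Fin m) ℂ =>
      toComplex H * M * toComplex G := by fun_prop
  have hres : Continuous fun ω : ℝ => resolvent (toComplex F) (Complex.I * (ω : ℂ)) := by
    rw [continuous_iff_continuousAt]
    intro ω
    have hmem : (Complex.I * (ω : ℂ)) ∈ resolventSet ℂ (toComplex F) := by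
      rw [spectrum.mem_resolventSet_iff, Algebra.algebraMap_eq_smul_one]
      exact hst.isUnit_smul_one_sub (I_mul_ofReal_re ω).ge
    have hc : ContinuousAt (fun ω : ℝ => Complex.I * (ω : ℂ)) ω := by fun_prop
    exact ContinuousAt.comp (f := fun ω : ℝ => Complex.I * (ω : ℂ)) (g := resolvent (toComplex F))
      (spectrum.hasDerivAt_resolvent_const_left hmem).continuousAt hc
  have hcont : Continuous fun ω : ℝ => ‖transferFunction F G H (Complex.I * ω)‖ := by
    simp_rw [htf]
    exact (hmul.comp hres).norm
  have hcob : Tendsto (fun ω : ℝ => Complex.I * (ω : ℂ)) (cocompact ℝ) (Bornology.cobounded ℂ) := by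
    rw [← tendsto_norm_atTop_iff_cobounded]
    exact (tendsto_norm_cocompact_atTop (E := ℝ)).congr fun ω => by simp
  have hlim : Tendsto (fun ω : ℝ => ‖transferFunction F G H (Complex.I * ω)‖) (cocompact ℝ)
      (𝓝 0) := by
    simp_rw [htf]
    have h1 := (hmul.norm.tendsto 0).comp
      ((spectrum.resolvent_tendsto_cobounded (𝕜 := ℂ) (toComplex F)).comp hcob)
    rw [Matrix.mul_zero, Matrix.zero_mul, norm_zero] at h1
    exact h1
  -- Truncating below at `γ / 2` makes the function constant near infinity, hence a maximum is
  -- attained.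
  obtain ⟨ω₀, hω₀⟩ := (hcont.max (continuous_const (y := γ / 2))).exists_forall_ge' 0 (by
    filter_upwards [hlim.eventually_lt_const (half_pos hγ)] with ω hω
    rw [max_eq_right hω.le]
    exact le_max_right _ _)
  have hlt : max ‖transferFunction F G H (Complex.I * ω₀)‖ (γ / 2) < γ :=
    max_lt (h ω₀) (half_lt_self hγ)
  refine lt_of_le_of_lt (iSup_le fun ω => ?_) ((ENNReal.ofReal_lt_ofReal_iff hγ).2 hlt)
  exact ENNReal.ofReal_le_ofReal ((le_max_left _ _).trans (hω₀ ω))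

lemma norm_lt_of_hInftyNorm_lt {T : ℂ → Matrix (Fin p) (Fin n) ℂ} {γ : ℝ} (hγ : 0 < γ)
    (h : hInftyNorm T < ENNReal.ofReal γ) (ω : ℝ) : ‖T (Complex.I * ω)‖ < γ :=
  (ENNReal.ofReal_lt_ofReal_iff hγ).1
    (lt_of_le_of_lt (le_iSup (fun ω : ℝ => ENNReal.ofReal ‖T (Complex.I * (ω : ℂ))‖) ω) h)

end FrequencyDomain

/-! ### Passage between real and complex matrices. -/

section Complexification

open scoped ComplexOrder

variable {m n p q : ℕ}

lemma toComplex_mul (M : Matrix (Fin m) (Fin n) ℝ) (N : Matrix (Fin n) (Fin p) ℝ) :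
    toComplex (M * N) = toComplex M * toComplex N :=
  Matrix.map_mul (f := Complex.ofRealHom)

lemma toComplex_add (M N : Matrix (Fin m) (Fin n) ℝ) :
    toComplex (M + N) = toComplex M + toComplex N :=
  Matrix.map_add _ Complex.ofReal_add M N

lemma toComplex_zero : toComplex (0 : Matrix (Fin m) (Fin n) ℝ) = 0 := by
  ext; simp

lemma toComplex_one : toComplex (1 : Matrix (Fin m) (Fin m) ℝ) = 1 :=
  Matrix.map_one _ Complex.ofReal_zero Complex.ofReal_one

lemma toComplex_smul (c : ℝ) (M : Matrix (Fin m) (Fin n) ℝ) :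
    toComplex (c • M) = (c : ℂ) • toComplex M := by
  ext; simp

lemma toComplex_transpose (M : Matrix (Fin m) (Fin n) ℝ) : toComplex Mᵀ = (toComplex M)ᴴ := by
  ext; simp [Matrix.conjTranspose_apply]

lemma toComplex_injective :
    Function.Injective (toComplex : Matrix (Fin m) (Fin n) ℝ → Matrix (Fin m) (Fin n) ℂ) :=
  Matrix.map_injective Complex.ofReal_injective

open scoped MatrixOrder in
lemma transpose_sqrt_mul_sqrt {M : Matrix (Fin m) (Fin m) ℝ} (hM : M.PosSemidef) :
    (CFC.sqrt M)ᵀ * CFC.sqrt M = M := by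
  have h1 : (CFC.sqrt M).PosSemidef := Matrix.nonneg_iff_posSemidef.1 (CFC.sqrt_nonneg M)
  rw [← Matrix.conjTranspose_eq_transpose_of_trivial, h1.1.eq, CFC.sqrt_mul_sqrt_self M hM.nonneg]

open scoped MatrixOrder in
lemma posSemidef_toComplex_iff {M : Matrix (Fin m) (Fin m) ℝ} :
    (toComplex M).PosSemidef ↔ M.PosSemidef := by
  constructor
  · intro h
    refine Matrix.PosSemidef.of_dotProduct_mulVec_nonneg ?_ fun x => ?_
    · have h1 := h.1.eq
      rw [← toComplex_transpose] at h1
      exact toComplex_injective h1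
    · have h1 := h.dotProduct_mulVec_nonneg (Complex.ofReal ∘ x)
      have h2 : star (Complex.ofReal ∘ x) ⬝ᵥ toComplex M *ᵥ (Complex.ofReal ∘ x)
          = ((star x ⬝ᵥ M *ᵥ x : ℝ) : ℂ) := by
        simp [dotProduct, Matrix.mulVec]
      rw [h2] at h1
      exact_mod_cast h1
  · intro h
    -- A real factorization `M = Lᵀ L` complexifies to `L* L`.
    rw [← transpose_sqrt_mul_sqrt h, toComplex_mul, toComplex_transpose]
    exact Matrix.posSemidef_conjTranspose_mul_self _

end Complexification

/-! ### The bounded real lemma and its converse for Riccati inequalities. -/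

section BoundedReal

open scoped ComplexOrder

variable {m n p : ℕ}

lemma posSemidef_mul_transpose (G : Matrix (Fin m) (Fin n) ℝ) {c : ℝ} (hc : 0 ≤ c) :
    (c • (G * Gᵀ)).PosSemidef := by
  have h := Matrix.posSemidef_self_mul_conjTranspose G
  rw [Matrix.conjTranspose_eq_transpose_of_trivial] at h
  exact h.smul hc

lemma mulVec_scaled_gram (G : Matrix (Fin m) (Fin n) ℝ) (γ : ℝ) (y : Fin m → ℂ) :
    toComplex ((γ ^ 2)⁻¹ • (G * Gᵀ)) *ᵥ y
      = toComplex G *ᵥ (((γ : ℂ) ^ 2)⁻¹ • (toComplex G)ᴴ *ᵥ y) := by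
  rw [toComplex_smul, toComplex_mul, toComplex_transpose, Matrix.mulVec_smul,
    Matrix.smul_mulVec, Matrix.mulVec_mulVec]
  push_cast
  rfl

lemma star_output_dotProduct_output (H : Matrix (Fin p) (Fin m) ℝ) (x : Fin m → ℂ) :
    star (toComplex H *ᵥ x) ⬝ᵥ toComplex H *ᵥ x = star x ⬝ᵥ toComplex (Hᵀ * H) *ᵥ x := by
  rw [star_mulVec_dotProduct, Matrix.mulVec_mulVec, toComplex_mul, toComplex_transpose]

/-- A strict bound on the frequency response excludes imaginary eigenvalues of the Hamiltonian. -/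
lemma hamiltonian_re_ne_zero {F : Matrix (Fin m) (Fin m) ℝ} {G : Matrix (Fin m) (Fin n) ℝ}
    {H : Matrix (Fin p) (Fin m) ℝ} {γ : ℝ} (hγ : 0 < γ) (hF : IsHurwitz F)
    (hT : ∀ ω : ℝ, ‖transferFunction F G H (Complex.I * ω)‖ < γ) (z : ℂ)
    (v : (Fin m → ℂ) × (Fin m → ℂ)) (hv : v ≠ 0)
    (hz : hamiltonian (toComplex F) (toComplex ((γ ^ 2)⁻¹ • (G * Gᵀ))) (toComplex (Hᵀ * H)) v
      = z • v) : z.re ≠ 0 := by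
  intro hre
  have hst := (isHurwitz_iff_isStable F).1 hF
  obtain ⟨ω, rfl⟩ : ∃ ω : ℝ, z = Complex.I * ω := ⟨z.im, by
    apply Complex.ext <;> simp [hre]⟩
  obtain ⟨x, y⟩ := v
  rw [hamiltonian_apply] at hz
  have h1 := congrArg Prod.fst hz
  have h2 := congrArg Prod.snd hz
  simp only [Prod.smul_fst, Prod.smul_snd] at h1 h2
  -- The input encoded by the costate `y`: driven by it, the state is `x`, and the eigenvector
  -- equations give `‖H x‖² = γ² ‖u‖²`, against the strict bound unless `u = 0`.
  set u : Fin n → ℂ := ((γ : ℂ) ^ 2)⁻¹ • (toComplex G)ᴴ *ᵥ y with hu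
  have hγc : (γ : ℂ) ≠ 0 := by exact_mod_cast hγ.ne'
  have hSy : toComplex ((γ ^ 2)⁻¹ • (G * Gᵀ)) *ᵥ y = toComplex G *ᵥ u := mulVec_scaled_gram G γ y
  rw [hSy] at h1
  obtain ⟨x', hx', hTu⟩ := exists_state hF G H ω u
  obtain rfl : x = x' := state_unique hst (I_mul_ofReal_re ω).ge h1 hx'
  have hQ : star (toComplex H *ᵥ x) ⬝ᵥ toComplex H *ᵥ x = star x ⬝ᵥ toComplex (Hᵀ * H) *ᵥ x :=
    star_output_dotProduct_output H x
  have hGu : star (toComplex G *ᵥ u) ⬝ᵥ y = (γ : ℂ) ^ 2 * (star u ⬝ᵥ u) := by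
    rw [star_mulVec_dotProduct]
    have : (toComplex G)ᴴ *ᵥ y = ((γ : ℂ) ^ 2) • u := by
      rw [hu, smul_smul, mul_inv_cancel₀ (pow_ne_zero 2 hγc), one_smul]
    rw [this, dotProduct_smul, smul_eq_mul]
  have hQx : toComplex (Hᵀ * H) *ᵥ x = -((Complex.I * ω) • y) - (toComplex F)ᴴ *ᵥ y := by
    linear_combination (exp := 1) -h2
  have hGx : toComplex G *ᵥ u = (Complex.I * ω) • x - toComplex F *ᵥ x := by
    linear_combination (exp := 1) h1
  have heq : star (toComplex H *ᵥ x) ⬝ᵥ toComplex H *ᵥ x = (γ : ℂ) ^ 2 * (star u ⬝ᵥ u) := by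
    rw [hQ, ← hGu, hQx, hGx, star_sub, sub_dotProduct, star_mulVec_dotProduct, dotProduct_sub,
      dotProduct_neg, dotProduct_smul, star_smul, smul_dotProduct]
    simp
  have hu0 : u = 0 := by
    by_contra hne
    have hlt := star_mulVec_dotProduct_mulVec_lt (hT ω) hne
    rw [hTu, heq, ← Complex.ofReal_pow, Complex.re_ofReal_mul] at hlt
    exact lt_irrefl _ hlt
  have hx0 : x = 0 := by
    by_contra hne
    have := hst _ x hne (by rw [Matrix.toLin'_apply, ← h1, hu0]; simp)
    simp at this
  have hy0 : y = 0 := by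
    by_contra hne
    have := hst.re_pos_of_neg_conjTranspose hne (by rw [← h2, hx0]; simp)
    simp at this
  exact hv (by rw [hx0, hy0]; rfl)

lemma toComplex_riccati (F S Q P : Matrix (Fin m) (Fin m) ℝ) :
    toComplex (Fᵀ * P + P * F + Q + P * S * P) = (toComplex F)ᴴ * toComplex P
      + toComplex P * toComplex F + toComplex Q + toComplex P * toComplex S * toComplex P := by
  simp only [toComplex_add, toComplex_mul, toComplex_transpose]

/-- A real Riccati equation that has a complex stabilizing solution has a real one. -/
lemma exists_real_stabilizing_riccati {F S Q : Matrix (Fin m) (Fin m) ℝ} (hS : S.IsSymm)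
    (h : ∃ P : Matrix (Fin m) (Fin m) ℂ, P.PosSemidef ∧
      (toComplex F)ᴴ * P + P * toComplex F + toComplex Q + P * toComplex S * P = 0 ∧
      IsStable (Matrix.toLin' (toComplex F + toComplex S * P))) :
    ∃ P : Matrix (Fin m) (Fin m) ℝ, P.PosSemidef ∧ Fᵀ * P + P * F + Q + P * S * P = 0 ∧
      IsHurwitz (F + S * P) := by
  obtain ⟨P, hP, hric, hst⟩ := h
  let c : Matrix (Fin m) (Fin m) ℂ →+* Matrix (Fin m) (Fin m) ℂ :=
    (starRingEnd ℂ).mapMatrix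
  have hc : ∀ M : Matrix (Fin m) (Fin m) ℝ, c (toComplex M) = toComplex M := fun M => by
    ext; simp [c]
  have hcT : ∀ M : Matrix (Fin m) (Fin m) ℝ, c (toComplex M)ᴴ = (toComplex M)ᴴ := fun M => by
    rw [← toComplex_transpose, hc]
  have hSc : (toComplex S).IsHermitian := by
    rw [Matrix.IsHermitian, ← toComplex_transpose, hS.eq]
  -- The coefficients are real, so the entrywise conjugate of `P` is again a stabilizing solution;
  -- uniqueness makes `P` real.
  have hcP : P = c P := by
    refine stabilizing_riccati_unique hSc hP.1 hric ?_ hst ?_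
    · have := congrArg c hric
      simpa only [map_add, map_mul, hc, hcT, map_zero] using this
    · intro z x hx hz
      have h1 : (toComplex F + toComplex S * P) *ᵥ star x = (starRingEnd ℂ z) • star x := by
        have h2 := congrArg star hz
        have h3 : star ((toComplex F + toComplex S * c P) *ᵥ x)
            = c (toComplex F + toComplex S * c P) *ᵥ star x := by
          ext i
          simp [c, Matrix.mulVec, dotProduct]
        have h4 : c (c P) = P := by ext; simp [c]
        rw [Matrix.toLin'_apply, h3] at h2
        simp only [map_add, map_mul, hc, h4] at h2
        rw [h2, star_smul]
        rfl
      have := hst _ _ (by simpa using hx) h1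
      simpa using this
  obtain ⟨P₀, rfl⟩ : ∃ P₀ : Matrix (Fin m) (Fin m) ℝ, P = toComplex P₀ :=
    ⟨P.map Complex.re, by
      ext i j
      have h1 : P i j = (starRingEnd ℂ) (P i j) := congrFun (congrFun hcP i) j
      exact (Complex.conj_eq_iff_re.1 h1.symm).symm⟩
  refine ⟨P₀, posSemidef_toComplex_iff.1 hP, toComplex_injective ?_, ?_⟩
  · rw [toComplex_riccati, hric, toComplex_zero]
  · rw [isHurwitz_iff_isStable, toComplex_add, toComplex_mul]
    exact hst

/-- The bounded real lemma: a stable system with `H∞` norm less than `γ` has a stabilizing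
solution of its Riccati equation. -/
theorem exists_riccati_of_norm_lt {F : Matrix (Fin m) (Fin m) ℝ} {G : Matrix (Fin m) (Fin n) ℝ}
    {H : Matrix (Fin p) (Fin m) ℝ} {γ : ℝ} (hγ : 0 < γ) (hF : IsHurwitz F)
    (hT : ∀ ω : ℝ, ‖transferFunction F G H (Complex.I * ω)‖ < γ) :
    ∃ P : Matrix (Fin m) (Fin m) ℝ, P.PosSemidef ∧
      Fᵀ * P + P * F + Hᵀ * H + P * ((γ ^ 2)⁻¹ • (G * Gᵀ)) * P = 0 ∧
      IsHurwitz (F + (γ ^ 2)⁻¹ • (G * Gᵀ) * P) := by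
  have hS := posSemidef_mul_transpose G (c := (γ ^ 2)⁻¹) (by positivity)
  have hQ := Matrix.posSemidef_conjTranspose_mul_self H
  rw [Matrix.conjTranspose_eq_transpose_of_trivial] at hQ
  exact exists_real_stabilizing_riccati hS.1
    (exists_stabilizing_riccati ((isHurwitz_iff_isStable F).1 hF) (posSemidef_toComplex_iff.2 hS)
      (posSemidef_toComplex_iff.2 hQ) (hamiltonian_re_ne_zero hγ hF hT))

section Inequality

variable {F S Q P M : Matrix (Fin m) (Fin m) ℂ}

lemma quadratic_riccati (hP : P.IsHermitian)
    (h : Fᴴ * P + P * F + Q + P * S * P + M = 0) (x : Fin m → ℂ) :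
    star (F *ᵥ x) ⬝ᵥ P *ᵥ x + star (P *ᵥ x) ⬝ᵥ F *ᵥ x + star x ⬝ᵥ Q *ᵥ x
      + star (P *ᵥ x) ⬝ᵥ S *ᵥ (P *ᵥ x) + star x ⬝ᵥ M *ᵥ x = 0 := by
  have := congrArg (fun N => star x ⬝ᵥ N *ᵥ x) h
  simpa only [Matrix.add_mulVec, dotProduct_add, Matrix.zero_mulVec, dotProduct_zero,
    star_mulVec_dotProduct, hP.eq, Matrix.mulVec_mulVec, Matrix.mul_assoc] using this

/-- A positive semidefinite solution of the Riccati inequality with defect `M` shows stability,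
provided `F + S P` has no unstable eigenvector in the kernel of `M`. -/
lemma isStable_of_riccati_inequality (hS : S.PosSemidef) (hQ : Q.PosSemidef) (hP : P.PosSemidef)
    (hM : M.PosSemidef) (h : Fᴴ * P + P * F + Q + P * S * P + M = 0)
    (hker : ∀ (z : ℂ) (x : Fin m → ℂ), x ≠ 0 → M *ᵥ x = 0 → F *ᵥ x + S *ᵥ (P *ᵥ x) = z • x →
      z.re < 0) : IsStable (Matrix.toLin' F) := by
  intro z x hx hz
  by_contra hre
  push Not at hre
  rw [Matrix.toLin'_apply] at hz
  have h1 := quadratic_riccati hP.1 h x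
  have hPx := hP.dotProduct_mulVec_nonneg x
  have hQx := hQ.dotProduct_mulVec_nonneg x
  have hSx := hS.dotProduct_mulVec_nonneg (P *ᵥ x)
  have hMx := hM.dotProduct_mulVec_nonneg x
  have h2 : star (F *ᵥ x) ⬝ᵥ P *ᵥ x + star (P *ᵥ x) ⬝ᵥ F *ᵥ x
      = ((2 * z.re : ℝ) : ℂ) * (star x ⬝ᵥ P *ᵥ x) := by
    rw [hz, star_smul, smul_dotProduct, dotProduct_smul, star_mulVec_dotProduct, hP.1.eq,
      smul_eq_mul, smul_eq_mul, ← add_mul, add_comm]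
    congr 1
    exact Complex.add_conj z
  -- At an unstable eigenvector every term of the quadratic identity is nonnegative, so each
  -- vanishes. Then `S P x = 0` and `M x = 0`, and `hker` applies to `x`.
  have h3 : 0 ≤ star (F *ᵥ x) ⬝ᵥ P *ᵥ x + star (P *ᵥ x) ⬝ᵥ F *ᵥ x := by
    rw [h2]
    exact mul_nonneg (by exact_mod_cast (by linarith)) hPx
  have h4 := (add_eq_zero_iff_of_nonneg (add_nonneg (add_nonneg h3 hQx) hSx) hMx).1 h1
  have h5 := (add_eq_zero_iff_of_nonneg (add_nonneg h3 hQx) hSx).1 h4.1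
  have hS0 := (hS.dotProduct_mulVec_zero_iff _).1 h5.2
  have hM0 := (hM.dotProduct_mulVec_zero_iff _).1 h4.2
  have := hker z x hx hM0 (by rw [hS0, hz, add_zero])
  linarith

end Inequality

/-- A positive semidefinite solution of the Riccati inequality with defect `M` bounds the frequency
response strictly, provided `F + γ⁻² G Gᵀ P` has no unstable eigenvector in the kernel of `M`. -/
lemma norm_lt_of_riccati_inequality {F P M : Matrix (Fin m) (Fin m) ℝ}
    {G : Matrix (Fin m) (Fin n) ℝ} {H : Matrix (Fin p) (Fin m) ℝ} {γ : ℝ} (hγ : 0 < γ)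
    (hF : IsHurwitz F) (hP : P.PosSemidef) (hM : M.PosSemidef)
    (h : Fᵀ * P + P * F + Hᵀ * H + P * ((γ ^ 2)⁻¹ • (G * Gᵀ)) * P + M = 0)
    (hker : ∀ (z : ℂ) (x : Fin m → ℂ), x ≠ 0 → toComplex M *ᵥ x = 0 →
      toComplex F *ᵥ x + toComplex ((γ ^ 2)⁻¹ • (G * Gᵀ)) *ᵥ (toComplex P *ᵥ x) = z • x →
      z.re < 0) (ω : ℝ) : ‖transferFunction F G H (Complex.I * ω)‖ < γ := by
  refine l2_opNorm_lt_of_forall hγ fun u hu => ?_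
  obtain ⟨x, hx, hTu⟩ := exists_state hF G H ω u
  have hγc : (γ : ℂ) ≠ 0 := by exact_mod_cast hγ.ne'
  have hPc := posSemidef_toComplex_iff.2 hP
  have hMc := posSemidef_toComplex_iff.2 hM
  have hc : (toComplex F)ᴴ * toComplex P + toComplex P * toComplex F + toComplex (Hᵀ * H)
      + toComplex P * toComplex ((γ ^ 2)⁻¹ • (G * Gᵀ)) * toComplex P + toComplex M = 0 := by
    rw [← toComplex_riccati, ← toComplex_add, h, toComplex_zero]
  have h1 := quadratic_riccati hPc.1 hc x
  have hMx := hMc.dotProduct_mulVec_nonneg x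
  set y := toComplex P *ᵥ x with hy
  -- Completing the square: `w` is the deviation from the worst-case input, and `γ² ‖u‖² - ‖H x‖² =
  -- γ² ‖w‖² + x* M x`.
  set w := u - ((γ : ℂ) ^ 2)⁻¹ • (toComplex G)ᴴ *ᵥ y with hw
  have hSy : toComplex ((γ ^ 2)⁻¹ • (G * Gᵀ)) *ᵥ y
      = toComplex G *ᵥ (((γ : ℂ) ^ 2)⁻¹ • (toComplex G)ᴴ *ᵥ y) := mulVec_scaled_gram G γ y
  have hQ : star (toComplex H *ᵥ x) ⬝ᵥ toComplex H *ᵥ x = star x ⬝ᵥ toComplex (Hᵀ * H) *ᵥ x :=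
    star_output_dotProduct_output H x
  have hFx : toComplex F *ᵥ x = (Complex.I * ω) • x - toComplex G *ᵥ u := by
    linear_combination (exp := 1) hx
  have hxy : star y ⬝ᵥ x = star x ⬝ᵥ y := by
    rw [hy, star_mulVec_dotProduct, hPc.1.eq]
  have hGy : ∀ t : Fin n → ℂ, star y ⬝ᵥ toComplex G *ᵥ t = star ((toComplex G)ᴴ *ᵥ y) ⬝ᵥ t :=
    fun t => by rw [star_mulVec_dotProduct (toComplex G)ᴴ, Matrix.conjTranspose_conjTranspose]
  have hbal : (γ : ℂ) ^ 2 * (star u ⬝ᵥ u) - star (toComplex H *ᵥ x) ⬝ᵥ toComplex H *ᵥ x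
      = (γ : ℂ) ^ 2 * (star w ⬝ᵥ w) + star x ⬝ᵥ toComplex M *ᵥ x := by
    have hstar : star (((γ : ℂ) ^ 2)⁻¹) = ((γ : ℂ) ^ 2)⁻¹ := by simp
    have hstarI : star (Complex.I * (ω : ℂ)) = -(Complex.I * ω) := by simp
    rw [hSy, hFx, hGy, star_sub, star_smul, sub_dotProduct, dotProduct_sub, smul_dotProduct,
      dotProduct_smul, dotProduct_smul, hxy, hGy, star_mulVec_dotProduct, hstarI] at h1
    rw [hQ, hw, star_sub, star_smul, hstar, sub_dotProduct, dotProduct_sub, dotProduct_sub,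
      smul_dotProduct, smul_dotProduct, dotProduct_smul, dotProduct_smul]
    simp only [smul_eq_mul] at h1 ⊢
    field_simp at h1 ⊢
    linear_combination -h1
  have hw0 : 0 ≤ star w ⬝ᵥ w := dotProduct_star_self_nonneg w
  have hγ2 : (0 : ℂ) ≤ (γ : ℂ) ^ 2 := by exact_mod_cast sq_nonneg γ
  have hnn : 0 ≤ (γ : ℂ) ^ 2 * (star w ⬝ᵥ w) + star x ⬝ᵥ toComplex M *ᵥ x :=
    add_nonneg (mul_nonneg hγ2 hw0) hMx
  -- Equality would force `w = 0` and `M x = 0`. A nonzero `x` would then be an eigenvector of `F +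
  -- γ⁻² G Gᵀ P` at `iω`, excluded by `hker`; and `x = 0` gives `u = 0`.
  have hne : (γ : ℂ) ^ 2 * (star w ⬝ᵥ w) + star x ⬝ᵥ toComplex M *ᵥ x ≠ 0 := by
    intro h0
    have h2 := (add_eq_zero_iff_of_nonneg (mul_nonneg hγ2 hw0) hMx).1 h0
    have h3 : w = 0 := by
      have := (mul_eq_zero.1 h2.1).resolve_left (pow_ne_zero 2 hγc)
      exact dotProduct_star_self_eq_zero.1 this
    have hu' : u = ((γ : ℂ) ^ 2)⁻¹ • (toComplex G)ᴴ *ᵥ y := sub_eq_zero.1 h3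
    have hx0 : x = 0 := by
      by_contra hxne
      have := hker _ x hxne ((hMc.dotProduct_mulVec_zero_iff _).1 h2.2)
        (by rw [← hy, hSy, ← hu']; exact hx)
      simp at this
    apply hu
    rw [hu', hy, hx0]
    simp
  have hpos := lt_of_le_of_ne hnn hne.symm
  rw [← hbal, ← hTu] at hpos
  have := (Complex.lt_def.1 hpos).1
  rw [Complex.sub_re, ← Complex.ofReal_pow, Complex.re_ofReal_mul, Complex.zero_re] at this
  linarith

end BoundedReal

/-! ### Feasibility after a policy step. -/

section PolicyStep

open scoped ComplexOrder

variable {m d n l : ℕ} {A : Matrix (Fin m) (Fin m) ℝ} {B : Matrix (Fin m) (Fin d) ℝ}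
  {C : Matrix (Fin l) (Fin m) ℝ} {D : Matrix (Fin m) (Fin n) ℝ} {R : Matrix (Fin d) (Fin d) ℝ}
  {γ : ℝ} {K : Matrix (Fin d) (Fin m) ℝ} {P : Matrix (Fin m) (Fin m) ℝ}

lemma outputMatrix_transpose_mul_self (hR : R.PosSemidef) (C : Matrix (Fin l) (Fin m) ℝ)
    (K : Matrix (Fin d) (Fin m) ℝ) :
    (outputMatrix C R K)ᵀ * outputMatrix C R K = Cᵀ * C + Kᵀ * R * K := by
  refine transpose_sqrt_mul_sqrt ?_
  have h1 := Matrix.posSemidef_conjTranspose_mul_self C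
  have h2 := hR.conjTranspose_mul_mul_same K
  rw [Matrix.conjTranspose_eq_transpose_of_trivial] at h1 h2
  exact h1.add h2

lemma isStabilizingSolution_iff : IsStabilizingSolution A B C D R γ K P ↔ P.PosSemidef ∧
    (A - B * K)ᵀ * P + P * (A - B * K) + (Cᵀ * C + Kᵀ * R * K)
      + P * ((γ ^ 2)⁻¹ • (D * Dᵀ)) * P = 0 ∧
    IsHurwitz (A - B * K + (γ ^ 2)⁻¹ • (D * Dᵀ) * P) := by
  have h1 : (A - B * K)ᵀ * P + P * (A - B * K) + (Cᵀ * C + Kᵀ * R * K)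
      + P * ((γ ^ 2)⁻¹ • (D * Dᵀ)) * P = (A - B * K)ᵀ * P + P * (A - B * K) + Cᵀ * C + Kᵀ * R * K
      + (γ ^ 2)⁻¹ • (P * D * Dᵀ * P) := by
    rw [Matrix.mul_smul, Matrix.smul_mul, ← Matrix.mul_assoc P D]
    abel
  rw [h1, Matrix.smul_mul]
  exact ⟨fun h => ⟨h.1, h.2, h.3⟩, fun h => ⟨h.1, h.2.1, h.2.2⟩⟩

lemma exists_isStabilizingSolution (hR : R.PosDef) (hγ : 0 < γ)
    (hK : K ∈ feasibleSet A B C D R γ) : ∃ P, IsStabilizingSolution A B C D R γ K P := by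
  obtain ⟨P, hP⟩ := exists_riccati_of_norm_lt hγ hK.1 (norm_lt_of_hInftyNorm_lt hγ hK.2)
  rw [outputMatrix_transpose_mul_self hR.posSemidef] at hP
  exact ⟨P, isStabilizingSolution_iff.2 hP⟩

lemma IsStabilizingSolution.unique {Q : Matrix (Fin m) (Fin m) ℝ}
    (hP : IsStabilizingSolution A B C D R γ K P) (hQ : IsStabilizingSolution A B C D R γ K Q) :
    P = Q := by
  obtain ⟨hP1, hP2, hP3⟩ := isStabilizingSolution_iff.1 hP
  obtain ⟨hQ1, hQ2, hQ3⟩ := isStabilizingSolution_iff.1 hQ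
  have hS := posSemidef_toComplex_iff.2 (posSemidef_mul_transpose D (c := (γ ^ 2)⁻¹) (by positivity))
  rw [isHurwitz_iff_isStable, toComplex_add, toComplex_mul] at hP3 hQ3
  refine toComplex_injective (stabilizing_riccati_unique (Q := toComplex (Cᵀ * C + Kᵀ * R * K))
    hS.1 (posSemidef_toComplex_iff.2 hP1).1 ?_ ?_ hP3 hQ3)
  · rw [← toComplex_riccati, hP2, toComplex_zero]
  · rw [← toComplex_riccati, hQ2, toComplex_zero]

/-- A step `K - Z (R K - Bᵀ P)` preserves feasibility if `Z + Zᵀ - Zᵀ R Z` is positive definite. -/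
theorem mem_feasibleSet_of_step (hR : R.PosDef) (hγ : 0 < γ)
    (hP : IsStabilizingSolution A B C D R γ K P) {Z : Matrix (Fin d) (Fin d) ℝ}
    (hZ : (Z + Zᵀ - Zᵀ * R * Z).PosDef) :
    K - Z * (R * K - Bᵀ * P) ∈ feasibleSet A B C D R γ := by
  obtain ⟨hP1, hP2, hP3⟩ := isStabilizingSolution_iff.1 hP
  set E := R * K - Bᵀ * P with hE
  set N := Z + Zᵀ - Zᵀ * R * Z with hN
  set K' := K - Z * E with hK'
  have hPT : Pᵀ = P := hP1.1
  have hRT : Rᵀ = R := hR.1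
  have hM : (Eᵀ * N * E).PosSemidef := by
    have := hZ.posSemidef.conjTranspose_mul_mul_same E
    rwa [Matrix.conjTranspose_eq_transpose_of_trivial] at this
  -- With `R K = E + Bᵀ P`, the cross terms in `P B Z E` from the drift and from `K'ᵀ R K'` cancel;
  -- what remains is quadratic in `E`.
  have hric : (A - B * K')ᵀ * P + P * (A - B * K')
      + (outputMatrix C R K')ᵀ * outputMatrix C R K'
      + P * ((γ ^ 2)⁻¹ • (D * Dᵀ)) * P + Eᵀ * N * E = 0 := by
    rw [outputMatrix_transpose_mul_self hR.posSemidef, ← hP2]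
    have hET : Eᵀ = Kᵀ * R - P * B := by
      rw [hE, Matrix.transpose_sub, Matrix.transpose_mul, Matrix.transpose_mul, hPT, hRT,
        Matrix.transpose_transpose]
    have h1 : R * K = E + Bᵀ * P := by rw [hE, sub_add_cancel]
    have h2 : Kᵀ * R = Eᵀ + P * B := by rw [hET, sub_add_cancel]
    have h3 : K'ᵀ * R * K' = Kᵀ * R * K - (Eᵀ + P * B) * Z * E - Eᵀ * Zᵀ * (E + Bᵀ * P)
        + Eᵀ * Zᵀ * R * Z * E := by
      rw [← h1, ← h2, hK', Matrix.transpose_sub, Matrix.transpose_mul]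
      simp only [Matrix.mul_sub, Matrix.sub_mul, ← Matrix.mul_assoc]
      abel
    rw [h3, hK', hN]
    simp only [Matrix.transpose_sub, Matrix.transpose_mul, Matrix.mul_sub, Matrix.sub_mul,
      Matrix.mul_add, Matrix.add_mul, ← Matrix.mul_assoc]
    abel
  have hNE : ∀ x : Fin m → ℂ, toComplex (Eᵀ * N * E) *ᵥ x = 0 → toComplex E *ᵥ x = 0 := by
    intro x hx
    have hNc := posSemidef_toComplex_iff.2 hZ.posSemidef
    have h1 : star (toComplex E *ᵥ x) ⬝ᵥ toComplex N *ᵥ (toComplex E *ᵥ x) = 0 := by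
      rw [star_mulVec_dotProduct, ← toComplex_transpose, Matrix.mulVec_mulVec,
        Matrix.mulVec_mulVec, ← toComplex_mul, ← toComplex_mul, hx,
        dotProduct_zero]
    have h2 := (hNc.dotProduct_mulVec_zero_iff _).1 h1
    have h3 : N⁻¹ * N = 1 := Matrix.nonsing_inv_mul _
      ((Matrix.isUnit_iff_isUnit_det _).1 hZ.isUnit)
    rw [← Matrix.one_mulVec (toComplex E *ᵥ x), ← toComplex_one, ← h3, toComplex_mul,
      ← Matrix.mulVec_mulVec, h2, Matrix.mulVec_zero]
  -- On the kernel of `E` both gains act alike, so `P` being stabilizing for `K` settles the matter.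
  have hker : ∀ (z : ℂ) (x : Fin m → ℂ), x ≠ 0 → toComplex (Eᵀ * N * E) *ᵥ x = 0 →
      toComplex (A - B * K') *ᵥ x + toComplex ((γ ^ 2)⁻¹ • (D * Dᵀ)) *ᵥ (toComplex P *ᵥ x)
        = z • x → z.re < 0 := by
    intro z x hx hMx hz
    refine (isHurwitz_iff_isStable _).1 hP3 z x hx ?_
    have h1 : A - B * K' = A - B * K + B * Z * E := by
      rw [hK', Matrix.mul_sub, Matrix.mul_assoc]
      abel
    rw [h1, toComplex_add, toComplex_mul _ E, Matrix.add_mulVec, ← Matrix.mulVec_mulVec, hNE x hMx,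
      Matrix.mulVec_zero, add_zero] at hz
    rw [Matrix.toLin'_apply, toComplex_add, toComplex_mul _ P, Matrix.add_mulVec,
      ← Matrix.mulVec_mulVec, hz]
  have hHur : IsHurwitz (A - B * K') := by
    rw [isHurwitz_iff_isStable]
    refine isStable_of_riccati_inequality
      (Q := toComplex ((outputMatrix C R K')ᵀ * outputMatrix C R K'))
      (posSemidef_toComplex_iff.2 (posSemidef_mul_transpose D (c := (γ ^ 2)⁻¹) (by positivity)))
      (posSemidef_toComplex_iff.2 ?_) (posSemidef_toComplex_iff.2 hP1)
      (posSemidef_toComplex_iff.2 hM) ?_ hker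
    · have := Matrix.posSemidef_conjTranspose_mul_self (outputMatrix C R K')
      rwa [Matrix.conjTranspose_eq_transpose_of_trivial] at this
    · rw [← toComplex_riccati, ← toComplex_add, hric, toComplex_zero]
  exact ⟨hHur, hInftyNorm_lt_of_forall hHur D _ hγ
    (norm_lt_of_riccati_inequality hγ hHur hP1 hM hric hker)⟩

lemma posDef_one_sub_smul (hR : R.IsHermitian) {η : ℝ} (hη : 0 ≤ η) (h : η * ‖R‖ < 1) :
    (1 - η • R).PosDef := by
  refine Matrix.PosDef.of_dotProduct_mulVec_pos
    (Matrix.isHermitian_one.sub (hR.smul (k := η) (by simp [IsSelfAdjoint]))) fun {x} hx => ?_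
  have hx0 : 0 < ‖WithLp.toLp 2 x‖ := norm_pos_iff.2 (by simpa using hx)
  have h1 : star x ⬝ᵥ x = ‖WithLp.toLp 2 x‖ ^ 2 := by
    rw [dotProduct_comm, ← real_inner_self_eq_norm_sq]
    rfl
  have h2 : star x ⬝ᵥ R *ᵥ x ≤ ‖R‖ * ‖WithLp.toLp 2 x‖ ^ 2 := by
    have h3 : star x ⬝ᵥ R *ᵥ x
        = inner ℝ (WithLp.toLp 2 x) (WithLp.toLp 2 (R *ᵥ x)) := by
      rw [dotProduct_comm]
      rfl
    rw [h3]
    refine (real_inner_le_norm _ _).trans ?_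
    have h4 := Matrix.l2_opNorm_mulVec R (WithLp.toLp 2 x)
    calc _ ≤ ‖WithLp.toLp 2 x‖ * (‖R‖ * ‖WithLp.toLp 2 x‖) :=
          mul_le_mul_of_nonneg_left h4 (norm_nonneg _)
      _ = _ := by ring
  rw [Matrix.sub_mulVec, Matrix.one_mulVec, Matrix.smul_mulVec, dotProduct_sub, dotProduct_smul,
    h1, smul_eq_mul]
  nlinarith [mul_le_mul_of_nonneg_left h2 hη, pow_pos hx0 2]

lemma naturalPGStep_mem_feasibleSet (hR : R.PosDef) (hγ : 0 < γ)
    (hP : IsStabilizingSolution A B C D R γ K P) {η : ℝ} (hη : 0 < η) (h : η ≤ 1 / (2 * ‖R‖)) :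
    naturalPGStep B R η K P ∈ feasibleSet A B C D R γ := by
  have hstep : naturalPGStep B R η K P
      = K - ((2 * η) • (1 : Matrix (Fin d) (Fin d) ℝ)) * (R * K - Bᵀ * P) := by
    rw [naturalPGStep, Matrix.smul_mul, Matrix.one_mul]
  -- If `‖R‖ = 0` (when `d = 0`), division by zero turns the bound into `η ≤ 0`, contradicting `0 <
  -- η`.
  have hnorm : 0 < ‖R‖ := by
    by_contra hne
    have : ‖R‖ = 0 := le_antisymm (not_lt.1 hne) (norm_nonneg _)
    rw [this] at h
    norm_num at h
    linarith
  have hlt : η * ‖R‖ < 1 := by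
    rw [le_div_iff₀ (by positivity)] at h
    linarith
  rw [hstep]
  refine mem_feasibleSet_of_step hR hγ hP ?_
  have heq : (2 * η) • (1 : Matrix (Fin d) (Fin d) ℝ) + ((2 * η) • (1 : Matrix (Fin d) (Fin d) ℝ))ᵀ
      - ((2 * η) • (1 : Matrix (Fin d) (Fin d) ℝ))ᵀ * R * ((2 * η) • (1 : Matrix (Fin d) (Fin d) ℝ))
      = (4 * η) • (1 - η • R) := by
    simp only [Matrix.transpose_smul, Matrix.transpose_one, Matrix.smul_mul, Matrix.mul_smul,
      Matrix.one_mul, Matrix.mul_one]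
    module
  rw [heq]
  exact (posDef_one_sub_smul hR.1 hη.le hlt).smul (by positivity)

/-- Here `Z = 2η R⁻¹`, and the matrix to be checked collapses to `4η (1 - η) R⁻¹`. -/
lemma gaussNewtonStep_mem_feasibleSet (hR : R.PosDef) (hγ : 0 < γ)
    (hP : IsStabilizingSolution A B C D R γ K P) {η : ℝ} (hη : 0 < η) (h : η ≤ 1 / 2) :
    gaussNewtonStep B R η K P ∈ feasibleSet A B C D R γ := by
  have hinv : R⁻¹ * R = 1 :=
    Matrix.nonsing_inv_mul _ ((Matrix.isUnit_iff_isUnit_det _).1 hR.isUnit)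
  have hstep : gaussNewtonStep B R η K P = K - ((2 * η) • R⁻¹) * (R * K - Bᵀ * P) := by
    rw [gaussNewtonStep, Matrix.smul_mul, Matrix.mul_sub, ← Matrix.mul_assoc, hinv, Matrix.one_mul,
      Matrix.mul_assoc]
  rw [hstep]
  refine mem_feasibleSet_of_step hR hγ hP ?_
  have hT : (R⁻¹)ᵀ = R⁻¹ := hR.inv.1
  have heq : (2 * η) • R⁻¹ + ((2 * η) • R⁻¹)ᵀ - ((2 * η) • R⁻¹)ᵀ * R * ((2 * η) • R⁻¹)
      = (4 * η * (1 - η)) • R⁻¹ := by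
    simp only [Matrix.transpose_smul, hT, Matrix.smul_mul, Matrix.mul_smul, hinv, Matrix.one_mul]
    module
  rw [heq]
  exact hR.inv.smul (mul_pos (by positivity) (by linarith))

end PolicyStep

end MixedDesign

theorem theoremA1 {m d n l : ℕ} (A : Matrix (Fin m) (Fin m) ℝ) (B : Matrix (Fin m) (Fin d) ℝ)
    (C : Matrix (Fin l) (Fin m) ℝ) (D : Matrix (Fin m) (Fin n) ℝ) (R : Matrix (Fin d) (Fin d) ℝ)
    (hR : R.PosDef) (γ : ℝ) (hγ : 0 < γ) (K : Matrix (Fin d) (Fin m) ℝ)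
    (hK : K ∈ MixedDesign.feasibleSet A B C D R γ) :
    ∃ P : Matrix (Fin m) (Fin m) ℝ,
      MixedDesign.IsStabilizingSolution A B C D R γ K P ∧
      (∀ Q, MixedDesign.IsStabilizingSolution A B C D R γ K Q → Q = P) ∧
      ∀ (η : ℝ) (K' : Matrix (Fin d) (Fin m) ℝ), 0 < η →
        ((K' = MixedDesign.naturalPGStep B R η K P ∧ η ≤ 1 / (2 * ‖R‖)) ∨
          (K' = MixedDesign.gaussNewtonStep B R η K P ∧ η ≤ 1 / 2)) →
        K' ∈ MixedDesign.feasibleSet A B C D R γ ∧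
        ∃ P' : Matrix (Fin m) (Fin m) ℝ,
          MixedDesign.IsStabilizingSolution A B C D R γ K' P' := by
  obtain ⟨P, hP⟩ := MixedDesign.exists_isStabilizingSolution hR hγ hK
  refine ⟨P, hP, fun Q hQ => hQ.unique hP, fun η K' hη h => ?_⟩
  have hK' : K' ∈ MixedDesign.feasibleSet A B C D R γ := by
    rcases h with ⟨rfl, h⟩ | ⟨rfl, h⟩
    · exact MixedDesign.naturalPGStep_mem_feasibleSet hR hγ hP hη h
    · exact MixedDesign.gaussNewtonStep_mem_feasibleSet hR hγ hP hη h
  exact ⟨hK', MixedDesign.exists_isStabilizingSolution hR hγ hK'⟩
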